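/- Let $A\in\mathbb{R}^{m\times n}$ have full column rank, $b\in\mathbb{R}^m$, and let $x_{ls}=\arg\min_x\|Ax-b\|$, $r_{ls}=Ax_{ls}-b$ (Euclidean norms). Let $\theta\in[0,\infty]$. For $0\neq\bar x\in\mathbb{R}^n$ put $\bar r=A\bar x-b$, $\gamma=\|\bar r\|/\|\bar x\|$, $$\mu=\frac{\theta^2\|\bar x\|^2}{1+\theta^2\|\bar x\|^2}\quad(\mu=1\text{ if }\theta=\infty),\qquad \lambda_*=\lambda_{\min}\left(AA^T-\mu\frac{\bar r\bar r^T}{\|\bar x\|^2}\right),$$ where $\lambda_{\min}$ denotes the smallest eigenvalue, and define the normwise backward error $$\eta_F(\bar x)=\min\left\{\|(E,\theta e)\|_F \;:\; E\in\mathbb{R}^{m\times n},\ e\in\mathbb{R}^m,\ \bar x\text{ is a minimizer of } x\mapsto\|(A+E)x-(b+e)\|\right\},$$ where for $\theta=\infty$ only perturbations with $e=0$ are admitted and their size is $\|E\|_F$. (i) If $r_{ls}\neq0$, then for every $\bar x\ne 0$ the minimum defining $\eta_F(\bar x)$ is attained, $$\eta_F(\bar x)=(\gamma^2\mu+\lambda_*)^{1/2},\qquad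 \eta_F(\bar x)\le\frac{\|A^T\bar r\|}{\|\bar r\|},$$ and, if moreover $\theta>0$, then $\lambda_*<0$. (ii) If $r_{ls}=0$, there is $\delta>0$ such that for every $\bar x\neq0$ with $\|\bar x-x_{ls}\|<\delta$ one has $\lambda_*\ge0$, the minimum defining $\eta_F(\bar x)$ is attained, and $\eta_F(\bar x)=\gamma\sqrt{\mu}$. -/

import Mathlib

open scoped ENNReal Matrix

noncomputable section

namespace LeastSquares

variable {m n : ℕ}

/-- The residual `A x - b`. -/
def residual (A : Matrix (Fin m) (Fin n) ℝ) (b : EuclideanSpace ℝ (Fin m))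
    (x : EuclideanSpace ℝ (Fin n)) : EuclideanSpace ℝ (Fin m) :=
  WithLp.toLp 2 (A *ᵥ WithLp.ofLp x) - b

/-- `x` solves the least squares problem `min_z ‖A z - b‖` (Euclidean norm). -/
def IsSolution (A : Matrix (Fin m) (Fin n) ℝ) (b : EuclideanSpace ℝ (Fin m))
    (x : EuclideanSpace ℝ (Fin n)) : Prop :=
  ∀ z : EuclideanSpace ℝ (Fin n), ‖residual A b x‖ ≤ ‖residual A b z‖

section
attribute [local instance] Matrix.frobeniusNormedAddCommGroup

/-- The Frobenius norm `‖(E, t e)‖_F` of the `m × (n + 1)` matrix with blocks `E` and `t e`. -/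
def augFrobeniusNorm (t : ℝ) (E : Matrix (Fin m) (Fin n) ℝ) (e : EuclideanSpace ℝ (Fin m)) : ℝ :=
  ‖Matrix.fromCols E (Matrix.replicateCol (Fin 1) (WithLp.ofLp (t • e)))‖

end

/-- The sizes `‖(E, θ e)‖_F` of all perturbations `(E, e)` for which `x` solves
`min_z ‖(A + E) z - (b + e)‖`.  The value `θ = ∞` means that only `A` may be perturbed: then
`e = 0` is required and the size is `‖E‖_F`. -/
def backwardErrors (θ : ℝ≥0∞) (A : Matrix (Fin m) (Fin n) ℝ) (b : EuclideanSpace ℝ (Fin m))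
    (x : EuclideanSpace ℝ (Fin n)) : Set ℝ :=
  {s | ∃ (E : Matrix (Fin m) (Fin n) ℝ) (e : EuclideanSpace ℝ (Fin m)),
    (θ = ∞ → e = 0) ∧ IsSolution (A + E) (b + e) x ∧ s = augFrobeniusNorm θ.toReal E e}

/-- The normwise backward error `η_F(x)`. -/
def eta (θ : ℝ≥0∞) (A : Matrix (Fin m) (Fin n) ℝ) (b : EuclideanSpace ℝ (Fin m))
    (x : EuclideanSpace ℝ (Fin n)) : ℝ :=
  sInf (backwardErrors θ A b x)

/-- `γ = ‖A x - b‖ / ‖x‖`. -/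
def gamma (A : Matrix (Fin m) (Fin n) ℝ) (b : EuclideanSpace ℝ (Fin m))
    (x : EuclideanSpace ℝ (Fin n)) : ℝ :=
  ‖residual A b x‖ / ‖x‖

/-- `μ = θ² ‖x‖² / (1 + θ² ‖x‖²)`, and `μ = 1` for `θ = ∞`. -/
def mu (θ : ℝ≥0∞) (x : EuclideanSpace ℝ (Fin n)) : ℝ :=
  if θ = ∞ then 1 else θ.toReal ^ 2 * ‖x‖ ^ 2 / (1 + θ.toReal ^ 2 * ‖x‖ ^ 2)

/-- The smallest eigenvalue of a symmetric real matrix of positive size. -/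
def lambdaMin (M : Matrix (Fin m) (Fin m) ℝ) : ℝ :=
  sInf {t : ℝ | Module.End.HasEigenvalue (Matrix.toLin' M) t}

/-- `λ_* = λ_min (A Aᵀ - μ r rᵀ / ‖x‖²)` with `r = A x - b`. -/
def lambdaStar (θ : ℝ≥0∞) (A : Matrix (Fin m) (Fin n) ℝ) (b : EuclideanSpace ℝ (Fin m))
    (x : EuclideanSpace ℝ (Fin n)) : ℝ :=
  lambdaMin (A * Aᵀ - (mu θ x / ‖x‖ ^ 2) •
    Matrix.vecMulVec (WithLp.ofLp (residual A b x)) (WithLp.ofLp (residual A b x)))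

end LeastSquares

end

namespace LeastSquares

variable {m n : ℕ}

/-! Write c = μ/‖x‖² and r = Ax - b. An admissible perturbation either annihilates the residual,
costing at least c‖r‖², or leaves one in some unit direction v with vᵀE = -vᵀA. In the latter case
the part of E along v costs ‖vᵀA‖², and Cauchy-Schwarz on the rows of the part orthogonal to v costs
c(‖r‖² - (vᵀr)²); the total is c‖r‖² + q(v), with q the form of AAᵀ - c rrᵀ
(`le_augFrobeniusNorm_sq`). Both bounds are attained (`exists_perturbation`), so η² = c‖r‖² +
min(λ_*, 0). The sign of λ_* then decides: r_ls ⟂ range A makes q negative at r_ls when c > 0 and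
r_ls ≠ 0, while for r_ls = 0 one has r = A(x - x_ls), and Cauchy-Schwarz gives q ≥ 0 near x_ls. -/

lemma norm_sq_eq_dotProduct (x : EuclideanSpace ℝ (Fin n)) :
    ‖x‖ ^ 2 = x.ofLp ⬝ᵥ x.ofLp := by
  rw [EuclideanSpace.real_norm_sq_eq]
  simp [dotProduct, sq]

lemma dotProduct_self_nonneg (v : Fin n → ℝ) : 0 ≤ v ⬝ᵥ v :=
  dotProduct_star_self_nonneg v

lemma exists_smul_dotProduct_eq_one {v : Fin n → ℝ} (hv : v ≠ 0) :
    ∃ k : ℝ, (k • v) ⬝ᵥ (k • v) = 1 := by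
  have hpos : 0 < v ⬝ᵥ v := lt_of_le_of_ne (dotProduct_self_nonneg v)
    (fun h => hv (dotProduct_self_eq_zero.1 h.symm))
  refine ⟨(Real.sqrt (v ⬝ᵥ v))⁻¹, ?_⟩
  have h := Real.mul_self_sqrt hpos.le
  have h0 := (Real.sqrt_pos.2 hpos).ne'
  simp only [dotProduct_smul, smul_dotProduct, smul_eq_mul]
  field_simp
  linarith

/-! ### Residuals and the normal equations -/

lemma ofLp_residual (A : Matrix (Fin m) (Fin n) ℝ) (b : EuclideanSpace ℝ (Fin m))
    (x : EuclideanSpace ℝ (Fin n)) :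
    (residual A b x).ofLp = A *ᵥ x.ofLp - b.ofLp := rfl

lemma residual_eq_add (A : Matrix (Fin m) (Fin n) ℝ) (b : EuclideanSpace ℝ (Fin m))
    (x z : EuclideanSpace ℝ (Fin n)) :
    (residual A b z).ofLp = (residual A b x).ofLp + A *ᵥ (z.ofLp - x.ofLp) := by
  simp only [ofLp_residual, Matrix.mulVec_sub]
  abel

lemma norm_sq_residual (A : Matrix (Fin m) (Fin n) ℝ) (b : EuclideanSpace ℝ (Fin m))
    (x z : EuclideanSpace ℝ (Fin n)) :
    ‖residual A b z‖ ^ 2 = ‖residual A b x‖ ^ 2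
      + 2 * ((residual A b x).ofLp ᵥ* A ⬝ᵥ (z.ofLp - x.ofLp))
      + (A *ᵥ (z.ofLp - x.ofLp)) ⬝ᵥ (A *ᵥ (z.ofLp - x.ofLp)) := by
  rw [norm_sq_eq_dotProduct, norm_sq_eq_dotProduct, residual_eq_add A b x z,
    ← Matrix.dotProduct_mulVec]
  simp only [dotProduct_add, add_dotProduct]
  rw [dotProduct_comm (A *ᵥ (z.ofLp - x.ofLp)) (residual A b x).ofLp]
  ring

/-- The normal equations. -/
lemma isSolution_iff (A : Matrix (Fin m) (Fin n) ℝ) (b : EuclideanSpace ℝ (Fin m))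
    (x : EuclideanSpace ℝ (Fin n)) :
    IsSolution A b x ↔ (residual A b x).ofLp ᵥ* A = 0 := by
  constructor
  · intro h
    set g := (residual A b x).ofLp ᵥ* A with hg
    have key : ∀ t : ℝ, 0 < t → 2 * (g ⬝ᵥ g) ≤ t * ((A *ᵥ g) ⬝ᵥ (A *ᵥ g)) := by
      intro t ht
      have h1 := pow_le_pow_left₀ (norm_nonneg _) (h (WithLp.toLp 2 (x.ofLp - t • g))) 2
      rw [norm_sq_residual A b x (WithLp.toLp 2 (x.ofLp - t • g)), ← hg] at h1
      have h2 : (WithLp.toLp 2 (x.ofLp - t • g)).ofLp - x.ofLp = (-t) • g := by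
        simp
      rw [h2] at h1
      simp only [Matrix.mulVec_smul, dotProduct_smul, smul_dotProduct, smul_eq_mul] at h1
      have h3 : t * (2 * (g ⬝ᵥ g)) ≤ t * (t * ((A *ᵥ g) ⬝ᵥ (A *ᵥ g))) := by linarith
      exact le_of_mul_le_mul_left h3 ht
    have h0 : 0 ≤ g ⬝ᵥ g := dotProduct_self_nonneg g
    have hk : 0 ≤ (A *ᵥ g) ⬝ᵥ (A *ᵥ g) := dotProduct_self_nonneg _
    refine dotProduct_self_eq_zero.1 (le_antisymm ?_ h0)
    by_contra! hpos
    set k := (A *ᵥ g) ⬝ᵥ (A *ᵥ g)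
    -- The `+ 1` covers k = 0; this step length makes t * k at most g ⬝ᵥ g.
    have h4 := key ((g ⬝ᵥ g) / (k + 1)) (by positivity)
    have h5 : (g ⬝ᵥ g) / (k + 1) * k ≤ g ⬝ᵥ g := by
      rw [div_mul_eq_mul_div, div_le_iff₀ (by positivity)]
      nlinarith
    linarith
  · intro h z
    refine (sq_le_sq₀ (norm_nonneg _) (norm_nonneg _)).1 ?_
    rw [norm_sq_residual A b x z, h, zero_dotProduct]
    have := dotProduct_self_nonneg (A *ᵥ (z.ofLp - x.ofLp))
    linarith

/-! ### Size of a perturbation, row by row -/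

section
attribute [local instance] Matrix.frobeniusNormedAddCommGroup

lemma augFrobeniusNorm_nonneg (t : ℝ) (E : Matrix (Fin m) (Fin n) ℝ)
    (e : EuclideanSpace ℝ (Fin m)) : 0 ≤ augFrobeniusNorm t E e :=
  norm_nonneg _

lemma augFrobeniusNorm_sq (t : ℝ) (E : Matrix (Fin m) (Fin n) ℝ)
    (e : EuclideanSpace ℝ (Fin m)) :
    augFrobeniusNorm t E e ^ 2 = ∑ i, (E i ⬝ᵥ E i + t ^ 2 * e i ^ 2) := by
  unfold augFrobeniusNorm
  rw [Matrix.frobenius_norm_def, ← Real.sqrt_eq_rpow, Real.sq_sqrt (by positivity)]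
  simp [Fintype.sum_sum_type, dotProduct, sq, mul_mul_mul_comm]

end

/-- The coefficient `μ / ‖x‖²` of the rank-one term in `λ_*`. -/
noncomputable def coeff (θ : ℝ≥0∞) (x : EuclideanSpace ℝ (Fin n)) : ℝ := mu θ x / ‖x‖ ^ 2

lemma coeff_nonneg (θ : ℝ≥0∞) (x : EuclideanSpace ℝ (Fin n)) : 0 ≤ coeff θ x := by
  unfold coeff mu
  split_ifs <;> positivity

lemma mu_le_one (θ : ℝ≥0∞) (x : EuclideanSpace ℝ (Fin n)) : mu θ x ≤ 1 := by
  unfold mu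
  split_ifs
  · exact le_rfl
  · rw [div_le_one (by positivity)]
    linarith

lemma coeff_pos {θ : ℝ≥0∞} (hθ : θ ≠ 0) {x : EuclideanSpace ℝ (Fin n)} (hx : x ≠ 0) :
    0 < coeff θ x := by
  have hx' : 0 < ‖x‖ := norm_pos_iff.2 hx
  unfold coeff mu
  split_ifs with h
  · positivity
  · have : 0 < θ.toReal := ENNReal.toReal_pos hθ h
    positivity

lemma coeff_mul_norm_sq (θ : ℝ≥0∞) {x : EuclideanSpace ℝ (Fin n)} (hx : x ≠ 0) :
    coeff θ x * (x.ofLp ⬝ᵥ x.ofLp) = mu θ x := by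
  rw [← norm_sq_eq_dotProduct]
  exact div_mul_cancel₀ _ (by simpa using hx)

lemma gamma_sq_mul_mu (θ : ℝ≥0∞) (A : Matrix (Fin m) (Fin n) ℝ)
    (b : EuclideanSpace ℝ (Fin m)) (x : EuclideanSpace ℝ (Fin n)) :
    gamma A b x ^ 2 * mu θ x = coeff θ x * ‖residual A b x‖ ^ 2 := by
  unfold gamma coeff
  ring

/-- The weighted Cauchy-Schwarz inequality for one row of a perturbation. -/
lemma coeff_mul_sq_le {θ : ℝ≥0∞} {x : EuclideanSpace ℝ (Fin n)} (hx : x ≠ 0)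
    (y : Fin n → ℝ) (f : ℝ) (hf : θ = ∞ → f = 0) :
    coeff θ x * (y ⬝ᵥ x.ofLp - f) ^ 2 ≤ y ⬝ᵥ y + θ.toReal ^ 2 * f ^ 2 := by
  have hX : 0 < ‖x‖ ^ 2 := by have := norm_pos_iff.2 hx; positivity
  have hcs : (y ⬝ᵥ x.ofLp) ^ 2 ≤ (y ⬝ᵥ y) * ‖x‖ ^ 2 := by
    rw [norm_sq_eq_dotProduct]
    simpa [dotProduct, sq] using Finset.sum_mul_sq_le_sq_mul_sq Finset.univ y x.ofLp
  set X := ‖x‖ ^ 2 with hXdef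
  set a := y ⬝ᵥ x.ofLp
  set t := θ.toReal
  have hy : a ^ 2 / X ≤ y ⬝ᵥ y := by rwa [div_le_iff₀ hX]
  refine le_trans ?_ (add_le_add_left hy _)
  unfold coeff mu
  rw [← hXdef]
  split_ifs with h
  · rw [hf h]
    apply le_of_eq
    ring
  -- The defect is a perfect square, zero for a = -t²Xf: the optimal split between E and e.
  · have h1 : a ^ 2 / X + t ^ 2 * f ^ 2 - t ^ 2 * X / (1 + t ^ 2 * X) / X * (a - f) ^ 2
        = (a + t ^ 2 * X * f) ^ 2 / (X * (1 + t ^ 2 * X)) := by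
      field_simp
      ring
    have h2 : 0 ≤ (a + t ^ 2 * X * f) ^ 2 / (X * (1 + t ^ 2 * X)) := by positivity
    linarith

/-- Equality case of `coeff_mul_sq_le`: the cost of the row -c x with f = 1 - μ, which changes the
residual by -1. -/
lemma coeff_identity (θ : ℝ≥0∞) {x : EuclideanSpace ℝ (Fin n)} (hx : x ≠ 0) :
    coeff θ x ^ 2 * (x.ofLp ⬝ᵥ x.ofLp) + θ.toReal ^ 2 * (1 - mu θ x) ^ 2 = coeff θ x := by
  have hX : 0 < ‖x‖ ^ 2 := by have := norm_pos_iff.2 hx; positivity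
  rw [← norm_sq_eq_dotProduct]
  unfold coeff mu
  set X := ‖x‖ ^ 2
  split_ifs with h
  · field_simp
    simp
  · field_simp
    ring

/-! ### Lower bound -/

/-- The quadratic form of the matrix `A Aᵀ - μ r rᵀ / ‖x‖²`. -/
noncomputable def quadForm (θ : ℝ≥0∞) (A : Matrix (Fin m) (Fin n) ℝ) (b : EuclideanSpace ℝ (Fin m))
    (x : EuclideanSpace ℝ (Fin n)) (v : Fin m → ℝ) : ℝ :=
  (v ᵥ* A) ⬝ᵥ (v ᵥ* A) - coeff θ x * (v ⬝ᵥ (residual A b x).ofLp) ^ 2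

/-- Pythagoras for the projection I - vvᵀ applied to the columns of E. -/
lemma sum_sub_smul_dotProduct (E : Matrix (Fin m) (Fin n) ℝ) {v : Fin m → ℝ}
    (hv : v ⬝ᵥ v = 1) :
    ∑ i, (E i - v i • (v ᵥ* E)) ⬝ᵥ (E i - v i • (v ᵥ* E))
      = ∑ i, E i ⬝ᵥ E i - (v ᵥ* E) ⬝ᵥ (v ᵥ* E) := by
  set w := v ᵥ* E with hw
  have h1 : ∑ i, v i * (E i ⬝ᵥ w) = w ⬝ᵥ w := by
    nth_rewrite 2 [hw]
    rw [← Matrix.dotProduct_mulVec]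
    rfl
  have h2 : ∑ i, v i * v i = 1 := hv
  have h3 : ∀ i, (E i - v i • w) ⬝ᵥ (E i - v i • w)
      = E i ⬝ᵥ E i - 2 * (v i * (E i ⬝ᵥ w)) + v i * v i * (w ⬝ᵥ w) := by
    intro i
    simp only [dotProduct_sub, sub_dotProduct, dotProduct_smul, smul_dotProduct, smul_eq_mul]
    rw [dotProduct_comm w (E i)]
    ring
  simp only [h3, Finset.sum_add_distrib, Finset.sum_sub_distrib, ← Finset.mul_sum,
    ← Finset.sum_mul, h1, h2]
  ring

lemma sum_sub_mul_sq (e : Fin m → ℝ) {v : Fin m → ℝ} (hv : v ⬝ᵥ v = 1) :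
    ∑ i, (e i - v i * (v ⬝ᵥ e)) ^ 2 = e ⬝ᵥ e - (v ⬝ᵥ e) ^ 2 := by
  have h1 : ∑ i, v i * e i = v ⬝ᵥ e := rfl
  have h2 : ∑ i, v i * v i = 1 := hv
  have h4 : ∑ i, e i * e i = e ⬝ᵥ e := rfl
  have h3 : ∀ i, (e i - v i * (v ⬝ᵥ e)) ^ 2
      = e i * e i - 2 * (v ⬝ᵥ e) * (v i * e i) + v i * v i * (v ⬝ᵥ e) ^ 2 := by
    intro i; ring
  simp only [h3, Finset.sum_add_distrib, Finset.sum_sub_distrib, ← Finset.mul_sum,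
    ← Finset.sum_mul, h1, h2, h4]
  ring

/-- A perturbed residual vanishes, or its direction bounds the size of the perturbation. -/
lemma le_augFrobeniusNorm_sq {θ : ℝ≥0∞} {A : Matrix (Fin m) (Fin n) ℝ}
    {b : EuclideanSpace ℝ (Fin m)} {x : EuclideanSpace ℝ (Fin n)} (hx : x ≠ 0)
    {E : Matrix (Fin m) (Fin n) ℝ} {e : EuclideanSpace ℝ (Fin m)} (he : θ = ∞ → e = 0)
    (hs : IsSolution (A + E) (b + e) x) :
    coeff θ x * ‖residual A b x‖ ^ 2 ≤ augFrobeniusNorm θ.toReal E e ^ 2 ∨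
    ∃ v : Fin m → ℝ, v ⬝ᵥ v = 1 ∧ coeff θ x * ‖residual A b x‖ ^ 2 + quadForm θ A b x v
      ≤ augFrobeniusNorm θ.toReal E e ^ 2 := by
  rw [isSolution_iff] at hs
  rw [augFrobeniusNorm_sq, norm_sq_eq_dotProduct]
  set r := (residual A b x).ofLp with hr
  set s := (residual (A + E) (b + e) x).ofLp with hsdef
  have hsr : ∀ i, E i ⬝ᵥ x.ofLp - e i = s i - r i := by
    intro i
    have : s = r + (E *ᵥ x.ofLp - e.ofLp) := by
      simp only [hsdef, hr, ofLp_residual, Matrix.add_mulVec, WithLp.ofLp_add]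
      abel
    rw [this]
    simp [Matrix.mulVec]
  by_cases h0 : s = 0
  · left
    rw [dotProduct, Finset.mul_sum]
    refine Finset.sum_le_sum fun i _ => ?_
    have h1 := coeff_mul_sq_le hx (E i) (e i) (fun h => by rw [he h]; rfl)
    rw [hsr i, h0] at h1
    simpa [sq] using h1
  · right
    have hspos : 0 < s ⬝ᵥ s := lt_of_le_of_ne (dotProduct_self_nonneg s)
      (fun h => h0 (dotProduct_self_eq_zero.1 h.symm))
    set k := Real.sqrt (s ⬝ᵥ s) with hk
    have hkpos : 0 < k := Real.sqrt_pos.2 hspos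
    have hk2 : k * k = s ⬝ᵥ s := Real.mul_self_sqrt hspos.le
    obtain ⟨v, hv⟩ : ∃ v : Fin m → ℝ, s = k • v :=
      ⟨k⁻¹ • s, by rw [smul_smul, mul_inv_cancel₀ hkpos.ne', one_smul]⟩
    have hvv : v ⬝ᵥ v = 1 := by
      rw [hv] at hk2
      simp only [dotProduct_smul, smul_dotProduct, smul_eq_mul] at hk2
      have := hkpos.ne'
      field_simp at hk2
      exact hk2.symm
    have hvE : v ᵥ* E = -(v ᵥ* A) := by
      rw [hv, Matrix.smul_vecMul, Matrix.vecMul_add] at hs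
      rcases smul_eq_zero.1 hs with h | h
      · exact absurd h hkpos.ne'
      · exact eq_neg_of_add_eq_zero_right h
    refine ⟨v, hvv, ?_⟩
    have hdot : (v ᵥ* E) ⬝ᵥ x.ofLp - v ⬝ᵥ e.ofLp = k - v ⬝ᵥ r := by
      have h1 : E *ᵥ x.ofLp - e.ofLp = s - r := funext hsr
      rw [← Matrix.dotProduct_mulVec, ← dotProduct_sub, h1, dotProduct_sub, hv,
        dotProduct_smul, hvv]
      simp
    -- The projection I - vvᵀ kills s, so only the projected r remains.
    have hrow : ∀ i, coeff θ x * (r i - v i * (v ⬝ᵥ r)) ^ 2 ≤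
        (E i - v i • (v ᵥ* E)) ⬝ᵥ (E i - v i • (v ᵥ* E))
          + θ.toReal ^ 2 * (e i - v i * (v ⬝ᵥ e.ofLp)) ^ 2 := by
      intro i
      have h1 := coeff_mul_sq_le (θ := θ) hx (E i - v i • (v ᵥ* E)) (e i - v i * (v ⬝ᵥ e.ofLp))
        (fun h => by simp [he h])
      refine le_trans (le_of_eq ?_) h1
      congr 1
      rw [sub_dotProduct, smul_dotProduct, smul_eq_mul]
      have h2 := hsr i
      have h3 : s i = k * v i := by rw [hv]; rfl
      have h4 : E i ⬝ᵥ x.ofLp - v i * (v ᵥ* E ⬝ᵥ x.ofLp) - (e i - v i * (v ⬝ᵥ e.ofLp))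
          = -(r i - v i * (v ⬝ᵥ r)) := by
        linear_combination h2 + h3 - v i * hdot
      rw [h4]
      ring
    have hsum := Finset.sum_le_sum fun i (_ : i ∈ Finset.univ) => hrow i
    rw [← Finset.mul_sum, Finset.sum_add_distrib, ← Finset.mul_sum, sum_sub_mul_sq r hvv,
      sum_sub_mul_sq e.ofLp hvv, sum_sub_smul_dotProduct E hvv, hvE] at hsum
    rw [Finset.sum_add_distrib, ← Finset.mul_sum]
    have h5 : ∑ i, e i ^ 2 = e.ofLp ⬝ᵥ e.ofLp := by simp [dotProduct, sq]
    rw [h5]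
    simp only [neg_dotProduct, dotProduct_neg, neg_neg] at hsum
    unfold quadForm
    rw [← hr]
    nlinarith [mul_nonneg (sq_nonneg θ.toReal) (sq_nonneg (v ⬝ᵥ e.ofLp))]

/-! ### Optimal perturbations -/

/-- Every unit vector `v`, and `v = 0`, gives a perturbation for which `x` is a solution. -/
lemma exists_perturbation (θ : ℝ≥0∞) (A : Matrix (Fin m) (Fin n) ℝ)
    (b : EuclideanSpace ℝ (Fin m)) {x : EuclideanSpace ℝ (Fin n)} (hx : x ≠ 0)
    {v : Fin m → ℝ} (hv : v = 0 ∨ v ⬝ᵥ v = 1) :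
    ∃ s ∈ backwardErrors θ A b x, 0 ≤ s ∧
      s ^ 2 = coeff θ x * ‖residual A b x‖ ^ 2 + quadForm θ A b x v := by
  set r := (residual A b x).ofLp with hr
  set w := v ᵥ* A with hw
  set c := coeff θ x with hc
  set ρ := v ⬝ᵥ r with hρ
  set p : Fin m → ℝ := r - ρ • v with hp
  have hκρ : (v ⬝ᵥ v) * ρ = ρ := by
    rcases hv with h | h
    · simp [hρ, h]
    · rw [h, one_mul]
  have hκw : (v ⬝ᵥ v) • w = w := by
    rcases hv with h | h
    · simp [hw, h]
    · rw [h, one_smul]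
  have hvp : v ⬝ᵥ p = 0 := by
    rw [hp, dotProduct_sub, dotProduct_smul, smul_eq_mul]
    linear_combination -hκρ
  have hpp : p ⬝ᵥ p = r ⬝ᵥ r - ρ ^ 2 := by
    nth_rewrite 1 [hp]
    rw [sub_dotProduct, smul_dotProduct, hvp, hp, dotProduct_sub, dotProduct_smul,
      dotProduct_comm r v, ← hρ]
    simp only [smul_eq_mul]
    ring
  -- The first term makes v orthogonal to the range of A + E; the second, with e, removes the
  -- residual component p in shares μ and 1 - μ, leaving a multiple of v.
  set E : Matrix (Fin m) (Fin n) ℝ :=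
    -Matrix.vecMulVec v w - c • Matrix.vecMulVec p x.ofLp with hE
  set e : EuclideanSpace ℝ (Fin m) := WithLp.toLp 2 ((1 - mu θ x) • p) with he
  have hEi : ∀ i, E i = -(v i • w) - (c * p i) • x.ofLp := by
    intro i
    ext j
    simp [hE, Matrix.vecMulVec_apply]
    ring
  refine ⟨augFrobeniusNorm θ.toReal E e, ⟨E, e, ?_, ?_, rfl⟩, augFrobeniusNorm_nonneg _ _ _, ?_⟩
  · intro h
    simp [he, mu, h]
  · rw [isSolution_iff]
    have hres : (residual (A + E) (b + e) x).ofLp = (ρ - w ⬝ᵥ x.ofLp) • v := by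
      have h1 : (residual (A + E) (b + e) x).ofLp = r + (E *ᵥ x.ofLp - e.ofLp) := by
        simp only [hr, ofLp_residual, Matrix.add_mulVec, WithLp.ofLp_add]
        abel
      rw [h1]
      ext i
      have h2 : (E *ᵥ x.ofLp) i = E i ⬝ᵥ x.ofLp := rfl
      have h3 := coeff_mul_norm_sq θ hx
      rw [← hc] at h3
      have h4 : p i = r i - ρ * v i := rfl
      simp only [Pi.add_apply, Pi.sub_apply, Pi.smul_apply, smul_eq_mul, h2, hEi, he,
        sub_dotProduct, neg_dotProduct, smul_dotProduct]
      linear_combination -p i * h3 - h4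
    have hvE : v ᵥ* E = -w := by
      rw [hE, Matrix.vecMul_sub, Matrix.vecMul_neg, Matrix.vecMul_smul, Matrix.vecMul_vecMulVec,
        Matrix.vecMul_vecMulVec, hvp, hκw]
      simp
    rw [hres, Matrix.smul_vecMul, Matrix.vecMul_add, hvE, ← hw]
    simp
  · rw [augFrobeniusNorm_sq, norm_sq_eq_dotProduct]
    have hid := coeff_identity θ hx
    rw [← hc] at hid
    have hterm : ∀ i, E i ⬝ᵥ E i + θ.toReal ^ 2 * e i ^ 2
        = (v i * v i) * (w ⬝ᵥ w) + (v i * p i) * (2 * c * (w ⬝ᵥ x.ofLp)) + (p i * p i) * c := by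
      intro i
      have hei : e i = (1 - mu θ x) * p i := rfl
      rw [hEi, hei]
      simp only [sub_dotProduct, neg_dotProduct, smul_dotProduct, dotProduct_sub,
        dotProduct_neg, dotProduct_smul, smul_eq_mul]
      rw [dotProduct_comm x.ofLp w]
      linear_combination (p i) ^ 2 * hid
    have hvs : ∑ i, v i * v i = v ⬝ᵥ v := rfl
    have hps : ∑ i, p i * p i = p ⬝ᵥ p := rfl
    have hvps : ∑ i, v i * p i = v ⬝ᵥ p := rfl
    have hκ : (v ⬝ᵥ v) * (w ⬝ᵥ w) = w ⬝ᵥ w := by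
      rw [← smul_eq_mul, ← smul_dotProduct, hκw]
    simp only [hterm, Finset.sum_add_distrib, ← Finset.sum_mul, hvs, hps, hvps, hvp, hpp, hκ]
    unfold quadForm
    rw [← hr, ← hw, ← hρ, ← hc]
    ring

/-! ### Variational form of λ_* -/

/-- The smallest eigenvalue of a symmetric matrix is the minimum of its quadratic form on the
unit sphere. -/
lemma isLeast_lambdaMin (hm : 0 < m) {M : Matrix (Fin m) (Fin m) ℝ} (hM : M.IsHermitian) :
    IsLeast {t : ℝ | ∃ v : Fin m → ℝ, v ⬝ᵥ v = 1 ∧ v ⬝ᵥ M *ᵥ v = t} (lambdaMin M) := by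
  have : Nonempty (Fin m) := ⟨⟨0, hm⟩⟩
  set T := Matrix.toEuclideanCLM (n := Fin m) (𝕜 := ℝ) M with hT
  have hTs : IsSelfAdjoint T := hM.isSelfAdjoint.map (Matrix.toEuclideanCLM (n := Fin m) (𝕜 := ℝ))
  have hf : ∀ v : EuclideanSpace ℝ (Fin m), T.reApplyInnerSelf v = v.ofLp ⬝ᵥ M *ᵥ v.ofLp := by
    intro v
    rw [ContinuousLinearMap.reApplyInnerSelf_apply, real_inner_comm, hT,
      Matrix.inner_toEuclideanCLM]
    rfl
  obtain ⟨y, hy, hymin⟩ := (isCompact_sphere (0 : EuclideanSpace ℝ (Fin m)) 1).exists_isMinOn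
    (NormedSpace.sphere_nonempty.2 zero_le_one) T.reApplyInnerSelf_continuous.continuousOn
  have hy1 : ‖y‖ = 1 := by simpa using hy
  have hyy : y.ofLp ⬝ᵥ y.ofLp = 1 := by rw [← norm_sq_eq_dotProduct, hy1, one_pow]
  have hy0 : y ≠ 0 := by rintro rfl; simp at hy1
  have hle : ∀ v : Fin m → ℝ, v ⬝ᵥ v = 1 → y.ofLp ⬝ᵥ M *ᵥ y.ofLp ≤ v ⬝ᵥ M *ᵥ v := by
    intro v hv
    have hv1 : ‖(WithLp.toLp 2 v : EuclideanSpace ℝ (Fin m))‖ = 1 := by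
      rw [← sq_eq_sq₀ (norm_nonneg _) zero_le_one, norm_sq_eq_dotProduct, hv, one_pow]
    have h := hymin (a := WithLp.toLp 2 v) (by simpa using hv1)
    simpa only [Set.mem_ofPred_eq, hf] using h
  -- Lagrange multipliers: an extremum of the form on the sphere is an eigenvector.
  have heig : M *ᵥ y.ofLp = (y.ofLp ⬝ᵥ M *ᵥ y.ofLp) • y.ofLp := by
    have h := hTs.eq_smul_self_of_isLocalExtrOn_real (x₀ := y)
      (Or.inl (by rw [hy1]; exact hymin.localize))
    rw [ContinuousLinearMap.rayleighQuotient, hf, hy1] at h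
    simpa [hT] using congrArg WithLp.ofLp h
  have hmin : IsLeast {t : ℝ | Module.End.HasEigenvalue (Matrix.toLin' M) t}
      (y.ofLp ⬝ᵥ M *ᵥ y.ofLp) := by
    constructor
    · refine Module.End.hasEigenvalue_of_hasEigenvector (x := y.ofLp) ⟨?_, ?_⟩
      · rw [Module.End.mem_eigenspace_iff, Matrix.toLin'_apply]
        exact heig
      · intro h
        simp [h] at hyy
    · intro t ht
      obtain ⟨v, hv⟩ := ht.exists_hasEigenvector
      have hvt : M *ᵥ v = t • v := by simpa using hv.apply_eq_smul
      obtain ⟨k, hk⟩ := exists_smul_dotProduct_eq_one hv.2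
      have h := hle (k • v) hk
      rwa [Matrix.mulVec_smul, hvt, smul_comm k t v, dotProduct_smul, hk, smul_eq_mul,
        mul_one] at h
  rw [lambdaMin, hmin.csInf_eq]
  refine ⟨⟨y.ofLp, hyy, rfl⟩, ?_⟩
  rintro _ ⟨v, hv, rfl⟩
  exact hle v hv

lemma isLeast_lambdaStar (hm : 0 < m) (θ : ℝ≥0∞) (A : Matrix (Fin m) (Fin n) ℝ)
    (b : EuclideanSpace ℝ (Fin m)) (x : EuclideanSpace ℝ (Fin n)) :
    IsLeast {t : ℝ | ∃ v : Fin m → ℝ, v ⬝ᵥ v = 1 ∧ quadForm θ A b x v = t}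
      (lambdaStar θ A b x) := by
  have hM : (A * Aᵀ - (mu θ x / ‖x‖ ^ 2) • Matrix.vecMulVec (WithLp.ofLp (residual A b x))
      (WithLp.ofLp (residual A b x))).IsHermitian := by
    ext i j
    simp [Matrix.vecMulVec_apply, Matrix.mul_apply, mul_comm]
  have h := isLeast_lambdaMin hm hM
  have hq : ∀ v : Fin m → ℝ, v ⬝ᵥ (A * Aᵀ - (mu θ x / ‖x‖ ^ 2) • Matrix.vecMulVec
      (WithLp.ofLp (residual A b x)) (WithLp.ofLp (residual A b x))) *ᵥ v
      = quadForm θ A b x v := by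
    intro v
    rw [Matrix.sub_mulVec, dotProduct_sub, ← Matrix.mulVec_mulVec, Matrix.dotProduct_mulVec,
      Matrix.mulVec_transpose, Matrix.smul_mulVec, Matrix.vecMulVec_mulVec, dotProduct_smul]
    unfold quadForm coeff
    rw [op_smul_eq_smul, dotProduct_smul, dotProduct_comm _ v]
    simp only [smul_eq_mul]
    ring
  simp only [hq] at h
  exact h

/-! ### Formula for η and the sign of λ_* -/

/-- The backward error is attained and equals `(γ² μ + min(λ_*, 0))^{1/2}`. -/
lemma isLeast_backwardErrors (hm : 0 < m) (θ : ℝ≥0∞) (A : Matrix (Fin m) (Fin n) ℝ)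
    (b : EuclideanSpace ℝ (Fin m)) {x : EuclideanSpace ℝ (Fin n)} (hx : x ≠ 0) :
    IsLeast (backwardErrors θ A b x)
      (Real.sqrt (gamma A b x ^ 2 * mu θ x + min (lambdaStar θ A b x) 0)) := by
  obtain ⟨⟨v, hv, hvl⟩, hmin⟩ := isLeast_lambdaStar hm θ A b x
  rw [gamma_sq_mul_mu]
  constructor
  · obtain ⟨u, hu, hul⟩ : ∃ u : Fin m → ℝ, (u = 0 ∨ u ⬝ᵥ u = 1) ∧
        quadForm θ A b x u = min (lambdaStar θ A b x) 0 := by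
      rcases le_total (lambdaStar θ A b x) 0 with h | h
      · exact ⟨v, Or.inr hv, by rw [hvl, min_eq_left h]⟩
      · exact ⟨0, Or.inl rfl, by rw [min_eq_right h]; simp [quadForm]⟩
    obtain ⟨s, hs, hs0, hs2⟩ := exists_perturbation θ A b hx hu
    rwa [← hul, ← hs2, Real.sqrt_sq hs0]
  · rintro s ⟨E, e, he, hsol, rfl⟩
    refine Real.sqrt_le_iff.2 ⟨augFrobeniusNorm_nonneg _ _ _, ?_⟩
    rcases le_augFrobeniusNorm_sq hx he hsol with h | ⟨u, hu, h⟩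
    · linarith [min_le_right (lambdaStar θ A b x) 0]
    · linarith [min_le_left (lambdaStar θ A b x) 0, hmin ⟨u, hu, rfl⟩]

lemma eta_eq (hm : 0 < m) (θ : ℝ≥0∞) (A : Matrix (Fin m) (Fin n) ℝ)
    (b : EuclideanSpace ℝ (Fin m)) {x : EuclideanSpace ℝ (Fin n)} (hx : x ≠ 0) :
    eta θ A b x = Real.sqrt (gamma A b x ^ 2 * mu θ x + min (lambdaStar θ A b x) 0) :=
  (isLeast_backwardErrors hm θ A b hx).csInf_eq

/-- The quadratic form bounds `λ_*` also at vectors that are not normalized. -/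
lemma lambdaStar_mul_le (hm : 0 < m) (θ : ℝ≥0∞) (A : Matrix (Fin m) (Fin n) ℝ)
    (b : EuclideanSpace ℝ (Fin m)) (x : EuclideanSpace ℝ (Fin n)) (v : Fin m → ℝ) :
    lambdaStar θ A b x * (v ⬝ᵥ v) ≤ quadForm θ A b x v := by
  by_cases h0 : v = 0
  · simp [h0, quadForm]
  obtain ⟨k, hk⟩ := exists_smul_dotProduct_eq_one h0
  have h := (isLeast_lambdaStar hm θ A b x).2 ⟨_, hk, rfl⟩
  have h2 : quadForm θ A b x (k • v) = k ^ 2 * quadForm θ A b x v := by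
    unfold quadForm
    rw [Matrix.smul_vecMul]
    simp only [dotProduct_smul, smul_dotProduct, smul_eq_mul]
    ring
  have h3 : k ^ 2 * (v ⬝ᵥ v) = 1 := by
    rw [← hk]
    simp only [dotProduct_smul, smul_dotProduct, smul_eq_mul]
    ring
  have hk2 : 0 < k ^ 2 := lt_of_le_of_ne (sq_nonneg k) (fun h => by simp [← h] at h3)
  rw [h2] at h
  refine le_of_mul_le_mul_left ?_ hk2
  linear_combination h + lambdaStar θ A b x * h3

/-- At the least squares residual the quadratic form is `-(μ / ‖x‖²) ‖r_ls‖⁴`. -/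
lemma quadForm_residual {θ : ℝ≥0∞} {A : Matrix (Fin m) (Fin n) ℝ}
    {b : EuclideanSpace ℝ (Fin m)} {xls : EuclideanSpace ℝ (Fin n)} (hls : IsSolution A b xls)
    (x : EuclideanSpace ℝ (Fin n)) :
    quadForm θ A b x (residual A b xls).ofLp = -(coeff θ x * (‖residual A b xls‖ ^ 2) ^ 2) := by
  have h := (isSolution_iff A b xls).1 hls
  unfold quadForm
  rw [residual_eq_add A b xls x, dotProduct_add, Matrix.dotProduct_mulVec, h,
    norm_sq_eq_dotProduct]
  simp

end LeastSquares

open LeastSquares in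
theorem mainTheorem5 {m n : ℕ} (A : Matrix (Fin m) (Fin n) ℝ) (hA : A.rank = n)
    (b : EuclideanSpace ℝ (Fin m)) (θ : ℝ≥0∞)
    (xls : EuclideanSpace ℝ (Fin n)) (hls : LeastSquares.IsSolution A b xls) :
    (LeastSquares.residual A b xls ≠ 0 →
      ∀ x : EuclideanSpace ℝ (Fin n), x ≠ 0 →
        (θ ≠ 0 → LeastSquares.lambdaStar θ A b x < 0) ∧
        IsLeast (LeastSquares.backwardErrors θ A b x) (LeastSquares.eta θ A b x) ∧
        LeastSquares.eta θ A b x =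
          Real.sqrt (LeastSquares.gamma A b x ^ 2 * LeastSquares.mu θ x
            + LeastSquares.lambdaStar θ A b x) ∧
        LeastSquares.eta θ A b x ≤
          ‖(WithLp.toLp 2 (Aᵀ *ᵥ WithLp.ofLp (LeastSquares.residual A b x)) :
            EuclideanSpace ℝ (Fin n))‖ / ‖LeastSquares.residual A b x‖) ∧
    (LeastSquares.residual A b xls = 0 →
      ∃ δ : ℝ, 0 < δ ∧ ∀ x : EuclideanSpace ℝ (Fin n), x ≠ 0 → ‖x - xls‖ < δ →
        0 ≤ LeastSquares.lambdaStar θ A b x ∧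
        IsLeast (LeastSquares.backwardErrors θ A b x) (LeastSquares.eta θ A b x) ∧
        LeastSquares.eta θ A b x =
          LeastSquares.gamma A b x * Real.sqrt (LeastSquares.mu θ x)) := by
  -- Full column rank gives n ≤ m, so a spectrum exists.
  have hm : ∀ x : EuclideanSpace ℝ (Fin n), x ≠ 0 → 0 < m := by
    intro x hx
    by_contra h
    have h1 := A.rank_le_height
    have hn : n = 0 := by omega
    subst hn
    exact hx (Subsingleton.elim _ _)
  constructor
  · intro hr x hx
    have hm := hm x hx
    have hrpos : 0 < ‖residual A b xls‖ ^ 2 := by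
      have := norm_pos_iff.2 hr
      positivity
    have hle := lambdaStar_mul_le hm θ A b x (residual A b xls).ofLp
    rw [quadForm_residual hls, ← norm_sq_eq_dotProduct] at hle
    have hneg : lambdaStar θ A b x ≤ -(coeff θ x * ‖residual A b xls‖ ^ 2) := by
      refine le_of_mul_le_mul_right ?_ hrpos
      linarith
    have hnonpos : lambdaStar θ A b x ≤ 0 := by
      have := mul_nonneg (coeff_nonneg θ x) hrpos.le
      linarith
    have heta := eta_eq hm θ A b hx
    have hleast := isLeast_backwardErrors hm θ A b hx
    rw [← heta] at hleast
    rw [min_eq_left hnonpos] at heta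
    refine ⟨fun hθ => ?_, hleast, heta, ?_⟩
    · have := mul_pos (coeff_pos hθ hx) hrpos
      linarith
    · have hrx : 0 < ‖residual A b x‖ := lt_of_lt_of_le (norm_pos_iff.2 hr) (hls x)
      -- At v = r the rank-one term is c‖r‖⁴, which cancels γ²μ after division by ‖r‖².
      have hq := lambdaStar_mul_le hm θ A b x (residual A b x).ofLp
      unfold quadForm at hq
      rw [← norm_sq_eq_dotProduct] at hq
      rw [heta, gamma_sq_mul_mu]
      refine Real.sqrt_le_iff.2 ⟨by positivity, ?_⟩
      rw [div_pow, le_div_iff₀ (by positivity), Matrix.mulVec_transpose,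
        norm_sq_eq_dotProduct (WithLp.toLp 2 ((residual A b x).ofLp ᵥ* A))]
      linarith
  · intro hr
    -- Chosen to force ‖x - xls‖ ≤ ‖x‖; any radius works when xls = 0.
    refine ⟨if xls = 0 then 1 else ‖xls‖ / 2, ?_, ?_⟩
    · split_ifs with h
      · exact one_pos
      · have := norm_pos_iff.2 h
        positivity
    · intro x hx hδ
      have hm := hm x hx
      have hd : ‖x - xls‖ ≤ ‖x‖ := by
        split_ifs at hδ with h
        · simp [h]
        · have := norm_sub_norm_le xls x
          rw [norm_sub_rev] at this
          linarith
      have hxpos : 0 < ‖x‖ := norm_pos_iff.2 hx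
      have hcd : coeff θ x * ‖x - xls‖ ^ 2 ≤ 1 := by
        have h1 : coeff θ x * ‖x‖ ^ 2 ≤ 1 := by
          rw [norm_sq_eq_dotProduct, coeff_mul_norm_sq θ hx]
          exact mu_le_one θ x
        have h2 : ‖x - xls‖ ^ 2 ≤ ‖x‖ ^ 2 := pow_le_pow_left₀ (norm_nonneg _) hd 2
        exact (mul_le_mul_of_nonneg_left h2 (coeff_nonneg θ x)).trans h1
      have hnonneg : 0 ≤ lambdaStar θ A b x := by
        obtain ⟨⟨v, -, hvl⟩, -⟩ := isLeast_lambdaStar hm θ A b x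
        rw [← hvl]
        unfold quadForm
        rw [residual_eq_add A b xls x, hr, WithLp.ofLp_zero, zero_add, Matrix.dotProduct_mulVec]
        set w := v ᵥ* A
        have hcs : (w ⬝ᵥ (x.ofLp - xls.ofLp)) ^ 2 ≤ (w ⬝ᵥ w) * ‖x - xls‖ ^ 2 := by
          rw [norm_sq_eq_dotProduct]
          simpa [dotProduct, sq] using
            Finset.sum_mul_sq_le_sq_mul_sq Finset.univ w (x.ofLp - xls.ofLp)
        have h1 := mul_le_mul_of_nonneg_left hcs (coeff_nonneg θ x)
        have h2 := mul_le_mul_of_nonneg_left hcd (dotProduct_self_nonneg w)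
        linarith
      have heta := eta_eq hm θ A b hx
      have hleast := isLeast_backwardErrors hm θ A b hx
      rw [← heta] at hleast
      refine ⟨hnonneg, hleast, ?_⟩
      rw [heta, min_eq_right hnonneg, add_zero, Real.sqrt_mul (sq_nonneg _), Real.sqrt_sq]
      exact div_nonneg (norm_nonneg _) (norm_nonneg _)
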